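/- Let $d\ge 2$, $a$ groups, and $X_{ik}=\mu_i+\epsilon_{ik}$ ($i=1,\dots,a$, $k=1,2,\dots$) be independent random vectors in $\mathbb R^d$. Within each group the $\epsilon_{ik}$ are identically distributed, with $E(\epsilon_{i1})=0$, $E\|\epsilon_{i1}\|^4<\infty$, and covariance matrix $V_i=(v_{ijk})_{j,k\le d}$ with $v_{i11},\dots,v_{idd}>0$. Put $p=d(d+1)/2$ and $p_u=d(d-1)/2$. For a $d\times d$ matrix $A$ let $\mathrm{vech}(A)\in\mathbb R^p$ list the entries $A_{jk}$ with $j\le k$ row by row, and let $\mathrm{vech}^-(A)\in\mathbb R^{p_u}$ list those with $j<k$ row by row. Let $R_i=(v_{ijk}/\sqrt{v_{ijj}v_{ikk}})_{j,k}$ be the correlation matrix, $v_i=\mathrm{vech}(V_i)$, $r_i=\mathrm{vech}^-(R_i)$ and $\Sigma_i=\mathrm{Cov}(\mathrm{vech}(\epsilon_{i1}\epsilon_{i1}^\top))$. From $X_{i1},\dots,X_{in_i}$ form the empirical covariance matrix $\widehat V_i=\frac1{n_i-1}\sum_{k=1}^{n_i}(X_{ik}-\overline X_i)(X_{ik}-\overline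 X_i)^\top$ and the empirical correlation matrix $\widehat R_i$ belonging to it, and let $\widehat v_i=\mathrm{vech}(\widehat V_i)$, $\widehat r_i=\mathrm{vech}^-(\widehat R_i)$, $r=(r_1^\top,\dots,r_a^\top)^\top$, $\widehat r=(\widehat r_1^\top,\dots,\widehat r_a^\top)^\top$. Let $e_{k,m}$ be the $k$-th unit vector of $\mathbb R^m$. Let $a_k=1+\sum_{j=1}^{k-1}(d+1-j)$ for $k=1,\dots,d$, and let $b_1<\dots<b_{p_u}$ be the numbers in $\{1,\dots,p\}$ other than $a_1,\dots,a_d$. Let $H$ be the $d\times d$ matrix all of whose rows are $(a_1,\dots,a_d)$, $h_1=\mathrm{vech}^-(H)$, $h_2=\mathrm{vech}^-(H^\top)$, and $$M_1=\sum_{\ell=1}^{p_u}e_{\ell,p_u}\bigl(e_{h_{1,\ell},p}+e_{h_{2,\ell},p}\bigr)^\top,\qquad L_p^u=\sum_{\ell=1}^{p_u}e_{\ell,p_u}e_{b_\ell,p}^\top,$$ $$M(v_i,r_i)=\Bigl[L_p^u-\tfrac12\,\mathrm{diag}(r_i)M_1\Bigr]\,\mathrm{diag}\bigl(\mathrm{vech}\bigl((v_{i11},\dots,v_{idd})^\top(v_{i11},\dots,v_{idd})\bigr)\bigr)^{-1/2},\qquad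 \Upsilon_i=M(v_i,r_i)\,\Sigma_i\,M(v_i,r_i)^\top.$$ **Theorem.** For each group $i$, as $n_i\to\infty$, $$\sqrt{n_i}(\widehat r_i-r_i)=M(v_i,r_i)\sqrt{n_i}(\widehat v_i-v_i)+o_P(1)\qquad\text{and}\qquad \sqrt{n_i}(\widehat r_i-r_i)\xrightarrow{\mathcal D}\mathcal N_{p_u}(0,\Upsilon_i).$$ If moreover (A1) holds, that is, if $\min(n_1,\dots,n_a)\to\infty$ with $n_i/N\to\kappa_i\in(0,1]$ for $i=1,\dots,a$, where $N=\sum_{i=1}^a n_i$, then $$\sqrt N(\widehat r-r)\xrightarrow{\mathcal D}\mathcal N_{a p_u}\Bigl(0,\bigoplus_{i=1}^a\kappa_i^{-1}\Upsilon_i\Bigr).$$ -/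

import Mathlib

open MeasureTheory ProbabilityTheory Filter Matrix
open scoped Topology

noncomputable section

namespace CorrAsymptotics

/-! ### Half-vectorizations -/

/-- `p = d (d + 1) / 2`. -/
abbrev dimP (d : ℕ) : ℕ := d * (d + 1) / 2

/-- `p_u = d (d - 1) / 2`. -/
abbrev dimPu (d : ℕ) : ℕ := d * (d - 1) / 2

/-- The positions `(j, k)` with `j ≤ k`, inside all positions ordered row by row. -/
def upperPairs (d : ℕ) : Finset (Fin d ×ₗ Fin d) :=
  Finset.univ.filter fun x => (ofLex x).1 ≤ (ofLex x).2

/-- The positions `(j, k)` with `j < k`, inside all positions ordered row by row. -/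
def strictUpperPairs (d : ℕ) : Finset (Fin d ×ₗ Fin d) :=
  Finset.univ.filter fun x => (ofLex x).1 < (ofLex x).2

theorem card_upperPairs (d : ℕ) : (upperPairs d).card = dimP d := by
  have h : (upperPairs d).card = ∑ k : Fin d, ((k : ℕ) + 1) := by
    have h1 : (upperPairs d).card
        = (Finset.univ.filter fun x : Fin d × Fin d => x.1 ≤ x.2).card :=
      Finset.card_equiv ofLex (by intro x; simp [upperPairs])
    rw [h1, Finset.card_filter, Fintype.sum_prod_type_right]
    refine Finset.sum_congr rfl fun k _ => ?_
    rw [← Finset.card_filter, show (Finset.univ.filter fun x : Fin d => x ≤ k) = Finset.Iic k by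
      ext; simp, Fin.card_Iic]
  rw [h, Fin.sum_univ_eq_sum_range (fun k => k + 1) d, dimP]
  have := Finset.sum_range_id_mul_two (d + 1)
  rw [Finset.sum_range_succ'] at this
  simp only [add_zero, Nat.add_sub_cancel] at this
  rw [mul_comm d (d + 1), ← this, Nat.mul_div_cancel _ (by norm_num)]

theorem card_strictUpperPairs (d : ℕ) : (strictUpperPairs d).card = dimPu d := by
  have h : (strictUpperPairs d).card = ∑ k : Fin d, (k : ℕ) := by
    have h1 : (strictUpperPairs d).card
        = (Finset.univ.filter fun x : Fin d × Fin d => x.1 < x.2).card :=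
      Finset.card_equiv ofLex (by intro x; simp [strictUpperPairs])
    rw [h1, Finset.card_filter, Fintype.sum_prod_type_right]
    refine Finset.sum_congr rfl fun k _ => ?_
    rw [← Finset.card_filter, show (Finset.univ.filter fun x : Fin d => x < k) = Finset.Iio k by
      ext; simp, Fin.card_Iio]
  rw [h, Fin.sum_univ_eq_sum_range (fun k => k) d, dimPu, Finset.sum_range_id]

/-- `vech A`: the entries `A j k`, `j ≤ k`, listed row by row. -/
def vech {α : Type*} {d : ℕ} (A : Matrix (Fin d) (Fin d) α) : Fin (dimP d) → α := fun l =>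
  let x := ofLex ((upperPairs d).orderEmbOfFin (card_upperPairs d) l)
  A x.1 x.2

/-- `vech⁻ A`: the entries `A j k`, `j < k`, listed row by row. -/
def vechU {α : Type*} {d : ℕ} (A : Matrix (Fin d) (Fin d) α) : Fin (dimPu d) → α := fun l =>
  let x := ofLex ((strictUpperPairs d).orderEmbOfFin (card_strictUpperPairs d) l)
  A x.1 x.2

/-! ### The matrices `L_p^u`, `M_1` and `M(v, r)`

Positions in vectors are counted from one, as natural numbers; the element `l : Fin p`
stands for the position `l + 1`. -/

/-- `e_{k,p}`, the `k`-th unit vector of `ℝ^p` (`k = 1, …, p`). -/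
def unitVec (k p : ℕ) : Fin p → ℝ := fun l => if (l : ℕ) + 1 = k then 1 else 0

/-- `a_k = 1 + ∑_{j=1}^{k-1} (d + 1 - j)`; the element `k : Fin d` stands for the index `k + 1`. -/
def diagPos (d : ℕ) : Fin d → ℕ := fun k => 1 + ∑ j ∈ Finset.Icc 1 (k : ℕ), (d + 1 - j)

/-- `b`: the numbers from `1` to `p` that are not among the `a_k`, in ascending order. -/
def offDiagPos (d : ℕ) : Fin (dimPu d) → ℕ := fun l =>
  Nat.nth (fun m => 1 ≤ m ∧ m ≤ dimP d ∧ ∀ k, m ≠ diagPos d k) l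

/-- `H = 1_d a`, a column of ones times the row `a`. -/
def matH (d : ℕ) : Matrix (Fin d) (Fin d) ℕ := vecMulVec (fun _ => 1) (diagPos d)

/-- `M_1 = ∑_ℓ e_{ℓ,p_u} (e_{h₁(ℓ),p} + e_{h₂(ℓ),p})ᵀ`, with `h₁ = vech⁻ H`, `h₂ = vech⁻ Hᵀ`. -/
def matM1 (d : ℕ) : Matrix (Fin (dimPu d)) (Fin (dimP d)) ℝ :=
  ∑ l : Fin (dimPu d), vecMulVec (unitVec (l + 1) (dimPu d))
    (unitVec (vechU (matH d) l) (dimP d) + unitVec (vechU (matH d)ᵀ l) (dimP d))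

/-- `L_p^u = ∑_ℓ e_{ℓ,p_u} e_{b(ℓ),p}ᵀ`. -/
def matL (d : ℕ) : Matrix (Fin (dimPu d)) (Fin (dimP d)) ℝ :=
  ∑ l : Fin (dimPu d), vecMulVec (unitVec (l + 1) (dimPu d)) (unitVec (offDiagPos d l) (dimP d))

/-- `M(v, r) = [L_p^u - ½ diag(r) M_1] diag(vech(wᵀ w))^{-1/2}`, where `w` is the row of the
variances, that is of the diagonal entries of the covariance matrix `V` with `v = vech V`. -/
def matM {d : ℕ} (w : Fin d → ℝ) (r : Fin (dimPu d) → ℝ) :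
    Matrix (Fin (dimPu d)) (Fin (dimP d)) ℝ :=
  (matL d - (1 / 2 : ℝ) • (diagonal r * matM1 d)) *
    diagonal (fun l => vech (vecMulVec w w) l ^ (-(1 / 2) : ℝ))

/-! ### Population quantities -/

/-- The covariance matrix of a random vector. -/
def covMat {Ω : Type*} [MeasurableSpace Ω] {ι : Type*} (Y : Ω → ι → ℝ) (P : Measure Ω) :
    Matrix ι ι ℝ :=
  Matrix.of fun j k => cov[fun ω => Y ω j, fun ω => Y ω k; P]

/-- The correlation matrix that belongs to a covariance matrix (used for the population and for
the sample). -/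
def corrMat {d : ℕ} (V : Matrix (Fin d) (Fin d) ℝ) : Matrix (Fin d) (Fin d) ℝ :=
  Matrix.of fun j k => V j k / (√(V j j) * √(V k k))

/-- `V = Cov(ε)`. -/
def popCov {Ω : Type*} [MeasurableSpace Ω] {d : ℕ} (ε : Ω → EuclideanSpace ℝ (Fin d))
    (P : Measure Ω) : Matrix (Fin d) (Fin d) ℝ :=
  covMat (fun ω j => ε ω j) P

/-- `Σ = Cov(vech(ε εᵀ))`. -/
def popSigma {Ω : Type*} [MeasurableSpace Ω] {d : ℕ} (ε : Ω → EuclideanSpace ℝ (Fin d))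
    (P : Measure Ω) : Matrix (Fin (dimP d)) (Fin (dimP d)) ℝ :=
  covMat (fun ω => vech (vecMulVec (fun j => ε ω j) (fun k => ε ω k))) P

/-- `M(v, r)` at the population values `v = vech V`, `r = vech⁻ R`. -/
def popM {Ω : Type*} [MeasurableSpace Ω] {d : ℕ} (ε : Ω → EuclideanSpace ℝ (Fin d))
    (P : Measure Ω) : Matrix (Fin (dimPu d)) (Fin (dimP d)) ℝ :=
  matM (fun j => popCov ε P j j) (vechU (corrMat (popCov ε P)))

/-- `Υ = M(v, r) Σ M(v, r)ᵀ`. -/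
def popUpsilon {Ω : Type*} [MeasurableSpace Ω] {d : ℕ} (ε : Ω → EuclideanSpace ℝ (Fin d))
    (P : Measure Ω) : Matrix (Fin (dimPu d)) (Fin (dimPu d)) ℝ :=
  popM ε P * popSigma ε P * (popM ε P)ᵀ

/-! ### Empirical quantities -/

/-- The mean of the first `n` observations `x 0, …, x (n - 1)`. -/
def sampleMean {d : ℕ} (x : ℕ → EuclideanSpace ℝ (Fin d)) (n : ℕ) : EuclideanSpace ℝ (Fin d) :=
  (n : ℝ)⁻¹ • ∑ m ∈ Finset.range n, x m

/-- The empirical covariance matrix of the first `n` observations. -/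
def sampleCov {d : ℕ} (x : ℕ → EuclideanSpace ℝ (Fin d)) (n : ℕ) : Matrix (Fin d) (Fin d) ℝ :=
  Matrix.of fun j k => ((n : ℝ) - 1)⁻¹ *
    ∑ m ∈ Finset.range n, (x m j - sampleMean x n j) * (x m k - sampleMean x n k)

/-- `√n (v̂ - v)`, as a vector of `ℝ^p`; `x` are the observations, `V` is the true covariance
matrix. -/
def covError {d : ℕ} (V : Matrix (Fin d) (Fin d) ℝ) (x : ℕ → EuclideanSpace ℝ (Fin d)) (n : ℕ) :
    Fin (dimP d) → ℝ :=
  √(n : ℝ) • (vech (sampleCov x n) - vech V)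

/-- `r̂ - r`, as a vector of `ℝ^{p_u}`; `x` are the observations, `V` is the true covariance
matrix. -/
def corrDiff {d : ℕ} (V : Matrix (Fin d) (Fin d) ℝ) (x : ℕ → EuclideanSpace ℝ (Fin d)) (n : ℕ) :
    Fin (dimPu d) → ℝ :=
  vechU (corrMat (sampleCov x n)) - vechU (corrMat V)

end CorrAsymptotics

end

/-!
The empirical correlations are a smooth function of the empirical covariance matrix, so the theorem
is the delta method applied to a central limit theorem for covariance matrices.

*Covariance matrices.* Write `G n` for the matrix with the entries
`n^{-1/2} ∑_{m < n} (ε_{mj} ε_{mk} - V_{jk})`. Expanding the centered sum of squares gives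
`√n (V̂ - V) - G n` as a sum of three terms, each a null sequence times a sequence that is bounded
in probability (`sqrt_mul_sampleCov_sub`). The bounds come from Chebyshev's inequality for
normalized sums of i.i.d. variables (`boundedInProbability_inv_sqrt_mul_sum`), applied to the
coordinates of the errors and to their products; the products need the fourth moments. No law of
large numbers is needed: if `√n (V̂ - V)` is bounded in probability, then `V̂` is consistent.

*Linearization.* For `j < k` the correlation is `f (V j k, V j j, V k k)` with
`f (x, y, z) = x / (√y √z)`, which is differentiable where `y, z > 0`. The matrix `M(v, r)` lists
these derivatives (`matM_mulVec_vech`): the combinatorial content is that `diagPos` and `offDiagPos`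
are the positions of the diagonal and off-diagonal entries in `vech`
(`exists_diag_position`, `exists_offDiag_position`). The remainder of the first order expansion is
negligible by `tendstoInMeasure_delta_method`.

*Asymptotic normality.* By the Cramér–Wold device the central limit theorem on the line gives
`M(v, r) vech (G n) → N(0, M Σ Mᵀ)`
(`tendstoInDistribution_mulVec_inv_sqrt_mul_sum`), and Slutsky's theorem transfers this limit to
`√n (r̂ - r)`. In the pooled statement, block `i` is `√(N / n_i)` times the normalized error of
group `i`, with `√(N / n_i) → κ_i^{-1/2}`; the blocks are independent, so the characteristic
function of the pooled vector factorizes (`tendstoInDistribution_blocks`).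
-/

namespace CorrAsymptotics

/-! ### Positions in half-vectorizations and the rows of `M(v, r)` -/

/-- In the increasing enumeration of a finset, an element is preceded by as many elements as its
index says. -/
lemma card_filter_lt_orderEmbOfFin {α : Type*} [LinearOrder α] (s : Finset α) {n : ℕ}
    (h : s.card = n) (q : Fin n) :
    (s.filter (· < s.orderEmbOfFin h q)).card = q := by
  have : s.filter (· < s.orderEmbOfFin h q)
      = (Finset.Iio q).map (s.orderEmbOfFin h).toEmbedding := by
    ext x
    simp only [Finset.mem_filter, Finset.mem_map, Finset.mem_Iio, RelEmbedding.coe_toEmbedding]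
    constructor
    · rintro ⟨hx, hlt⟩
      obtain ⟨q', rfl⟩ : x ∈ Set.range (s.orderEmbOfFin h) := by simpa using hx
      exact ⟨q', by simpa using hlt, rfl⟩
    · rintro ⟨q', hq', rfl⟩
      exact ⟨s.orderEmbOfFin_mem h q', by simpa using hq'⟩
  rw [this, Finset.card_map, Fin.card_Iio]

lemma exists_orderEmbOfFin_eq {α : Type*} [LinearOrder α] {s : Finset α} {n : ℕ}
    (h : s.card = n) {x : α} (hx : x ∈ s) : ∃ q, s.orderEmbOfFin h q = x := by
  have : x ∈ Set.range (s.orderEmbOfFin h) := by simpa using hx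
  exact this

/-- The entries before the diagonal entry `(k, k)` in `vech` are those of the rows above it: the
entries `(i, k)` with `i < k` are among them, and row `k` contributes none. -/
lemma card_upperPairs_lt_diag (d : ℕ) (k : Fin d) :
    ((upperPairs d).filter (· < toLex (k, k))).card + 1 = diagPos d k := by
  have h1 : ((upperPairs d).filter (· < toLex (k, k))).card
      = (Finset.univ.filter fun x : Fin d × Fin d => x.1 < k ∧ x.1 ≤ x.2).card := by
    refine Finset.card_equiv ofLex fun x => ?_
    obtain ⟨x, rfl⟩ := toLex.surjective x
    simp only [upperPairs, Finset.mem_filter, Finset.mem_univ, true_and, ofLex_toLex,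
      Prod.Lex.toLex_lt_toLex]
    grind
  have h2 : ∀ i : Fin d, (∑ j : Fin d, if i < k ∧ i ≤ j then 1 else 0)
      = if (i : ℕ) < k then d - (i : ℕ) else 0 := by
    intro i
    by_cases hik : i < k
    · have hik' : (i : ℕ) < k := hik
      simp only [hik, true_and, hik', if_true]
      rw [← Finset.card_filter, show (Finset.univ.filter fun x : Fin d => i ≤ x) = Finset.Ici i by
        ext; simp, Fin.card_Ici]
    · have hik' : ¬ (i : ℕ) < k := hik
      simp [hik, hik']
  rw [h1, Finset.card_filter, Fintype.sum_prod_type, Finset.sum_congr rfl fun i _ => h2 i,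
    Fin.sum_univ_eq_sum_range (fun i => if i < (k : ℕ) then d - i else 0) d, ← Finset.sum_filter]
  have h3 : (Finset.range d).filter (· < (k : ℕ)) = Finset.range k := by
    ext i
    have := k.2
    simp only [Finset.mem_filter, Finset.mem_range]
    omega
  rw [h3, diagPos, add_comm, ← Finset.Ico_add_one_right_eq_Icc, Finset.sum_Ico_eq_sum_range]
  simp only [Nat.add_sub_cancel]
  congr 1
  exact Finset.sum_congr rfl fun i _ => by omega

/-- `diagPos d k` is the (one-based) position of the diagonal entry `(k, k)` in `vech`. -/
lemma exists_diag_position (d : ℕ) (k : Fin d) :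
    ∃ q : Fin (dimP d), (q : ℕ) + 1 = diagPos d k ∧
      (upperPairs d).orderEmbOfFin (card_upperPairs d) q = toLex (k, k) := by
  obtain ⟨q, hq⟩ := exists_orderEmbOfFin_eq (card_upperPairs d)
    (x := toLex (k, k)) (by simp [upperPairs])
  refine ⟨q, ?_, hq⟩
  rw [← card_upperPairs_lt_diag, ← hq, card_filter_lt_orderEmbOfFin]

/-- `offDiagPos d l` is the (one-based) position in `vech` of the `l`-th entry of `vech⁻`. -/
lemma exists_offDiag_position (d : ℕ) (l : Fin (dimPu d)) :
    ∃ q : Fin (dimP d), (q : ℕ) + 1 = offDiagPos d l ∧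
      (upperPairs d).orderEmbOfFin (card_upperPairs d) q
        = (strictUpperPairs d).orderEmbOfFin (card_strictUpperPairs d) l := by
  have hex : ∀ l : Fin (dimPu d), ∃ q : Fin (dimP d),
      (upperPairs d).orderEmbOfFin (card_upperPairs d) q
        = (strictUpperPairs d).orderEmbOfFin (card_strictUpperPairs d) l := by
    intro l
    refine exists_orderEmbOfFin_eq _ ?_
    have := (strictUpperPairs d).orderEmbOfFin_mem (card_strictUpperPairs d) l
    simp only [strictUpperPairs, upperPairs, Finset.mem_filter, Finset.mem_univ, true_and] at this ⊢
    exact this.le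
  choose f hf using hex
  have hmono : StrictMono f := by
    intro l l' hl
    rw [← ((upperPairs d).orderEmbOfFin (card_upperPairs d)).lt_iff_lt, hf, hf]
    simpa using hl
  set p : ℕ → Prop := fun m => 1 ≤ m ∧ m ≤ dimP d ∧ ∀ k, m ≠ diagPos d k with hp
  have hfin : (Set.ofPred p).Finite := (Set.finite_Icc 1 (dimP d)).subset fun m hm => ⟨hm.1, hm.2.1⟩
  have hS : hfin.toFinset = Finset.univ.image fun l => (f l : ℕ) + 1 := by
    ext m
    simp only [Set.Finite.mem_toFinset, Finset.mem_image, Finset.mem_univ, true_and]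
    constructor
    · rintro ⟨h1, h2, h3⟩
      set q : Fin (dimP d) := ⟨m - 1, by omega⟩ with hq
      set x := (upperPairs d).orderEmbOfFin (card_upperPairs d) q with hx
      have hxm := (upperPairs d).orderEmbOfFin_mem (card_upperPairs d) q
      rw [← hx] at hxm
      simp only [upperPairs, Finset.mem_filter, Finset.mem_univ, true_and] at hxm
      have hne : (ofLex x).1 ≠ (ofLex x).2 := by
        intro he
        obtain ⟨q', hq', hq''⟩ := exists_diag_position d (ofLex x).1
        have hxx : toLex ((ofLex x).1, (ofLex x).1) = x := by
          conv_lhs => rw [show ((ofLex x).1, (ofLex x).1) = ofLex x from Prod.ext rfl he]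
          simp
        rw [hxx, hx] at hq''
        have := ((upperPairs d).orderEmbOfFin (card_upperPairs d)).injective hq''
        refine h3 (ofLex x).1 ?_
        rw [← hq', this, hq]
        simp only
        omega
      obtain ⟨l', hl'⟩ := exists_orderEmbOfFin_eq (card_strictUpperPairs d) (x := x)
        (by simpa [strictUpperPairs] using lt_of_le_of_ne hxm hne)
      refine ⟨l', ?_⟩
      have : f l' = q := by
        apply ((upperPairs d).orderEmbOfFin (card_upperPairs d)).injective
        rw [hf, hl']
      rw [this, hq]
      simp only
      omega
    · rintro ⟨l', rfl⟩
      refine ⟨by omega, by have := (f l').2; omega, fun k hk => ?_⟩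
      obtain ⟨q', hq', hq''⟩ := exists_diag_position d k
      have : f l' = q' := Fin.ext (by omega)
      have h4 := (strictUpperPairs d).orderEmbOfFin_mem (card_strictUpperPairs d) l'
      rw [← hf, this, hq''] at h4
      simp [strictUpperPairs] at h4
  have hcard : hfin.toFinset.card = dimPu d := by
    rw [hS, Finset.card_image_of_injective, Finset.card_univ, Fintype.card_fin]
    intro l l' hl
    exact hmono.injective (Fin.ext (by simpa using hl))
  refine ⟨f l, ?_, hf l⟩
  have hu := Finset.orderEmbOfFin_unique hcard (f := fun l => (f l : ℕ) + 1)
    (fun l => by rw [hS]; exact Finset.mem_image_of_mem _ (Finset.mem_univ _))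
    (fun l l' hl => by simpa using hmono hl)
  rw [congrFun hu l, offDiagPos, Nat.nth_eq_orderEmbOfFin hfin (by rw [hcard]; exact l.2)]
  simp

lemma unitVec_dotProduct {p : ℕ} (q : Fin p) (w : Fin p → ℝ) {k : ℕ} (hk : (q : ℕ) + 1 = k) :
    unitVec k p ⬝ᵥ w = w q := by
  subst hk
  simp [dotProduct, unitVec, Fin.val_inj]

/-- A sum of the rank-one matrices `e_l u_lᵀ` has the rows `u_lᵀ`. -/
lemma sum_vecMulVec_unitVec_mulVec {m p : ℕ} (u : Fin m → Fin p → ℝ) (w : Fin p → ℝ)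
    (l : Fin m) :
    ((∑ l : Fin m, vecMulVec (unitVec (l + 1) m) (u l)) *ᵥ w) l = u l ⬝ᵥ w := by
  rw [Matrix.sum_mulVec, Finset.sum_apply, Finset.sum_eq_single l]
  · simp [vecMulVec_mulVec, unitVec]
  · intro b _ hb
    have : (l : ℕ) ≠ b := fun h => hb (Fin.ext h.symm)
    simp [vecMulVec_mulVec, unitVec, this]
  · simp

lemma matL_mulVec_vech {d : ℕ} (A : Matrix (Fin d) (Fin d) ℝ) : matL d *ᵥ vech A = vechU A := by
  ext l
  obtain ⟨q, hq, hx⟩ := exists_offDiag_position d l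
  rw [matL, sum_vecMulVec_unitVec_mulVec, unitVec_dotProduct q _ hq]
  simp [vech, vechU, hx]

lemma matM1_mulVec_vech {d : ℕ} (A : Matrix (Fin d) (Fin d) ℝ) :
    matM1 d *ᵥ vech A = vechU (Matrix.of fun j k => A k k + A j j) := by
  ext l
  rw [matM1, sum_vecMulVec_unitVec_mulVec, add_dotProduct]
  set x := ofLex ((strictUpperPairs d).orderEmbOfFin (card_strictUpperPairs d) l) with hx
  obtain ⟨q₁, hq₁, hx₁⟩ := exists_diag_position d x.2
  obtain ⟨q₂, hq₂, hx₂⟩ := exists_diag_position d x.1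
  rw [unitVec_dotProduct q₁, unitVec_dotProduct q₂]
  · simp [vech, vechU, hx₁, hx₂, ← hx]
  · simp [hq₂, vechU, matH, vecMulVec_apply, ← hx]
  · simp [hq₁, vechU, matH, vecMulVec_apply, ← hx]

/-- The entry of `M(v, r) vech A` at the position of `(j, k)` is the derivative of
`V ↦ V j k / √(V j j * V k k)` in the direction `A`. -/
lemma matM_mulVec_vech {d : ℕ} (w : Fin d → ℝ) (hw : ∀ j, 0 < w j)
    (R A : Matrix (Fin d) (Fin d) ℝ) :
    matM w (vechU R) *ᵥ vech A = vechU (Matrix.of fun j k =>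
      A j k / (√(w j) * √(w k)) - 1 / 2 * R j k * (A k k / w k + A j j / w j)) := by
  have hD : diagonal (fun l => vech (vecMulVec w w) l ^ (-(1 / 2) : ℝ)) *ᵥ vech A
      = vech (Matrix.of fun j k => A j k / (√(w j) * √(w k))) := by
    ext l
    rw [mulVec_diagonal]
    simp only [vech, vecMulVec_apply, of_apply]
    rw [Real.rpow_neg (mul_nonneg (hw _).le (hw _).le), ← Real.sqrt_eq_rpow,
      Real.sqrt_mul (hw _).le, div_eq_inv_mul]
  rw [matM, ← mulVec_mulVec, hD, sub_mulVec, smul_mulVec, ← mulVec_mulVec, matL_mulVec_vech,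
    matM1_mulVec_vech]
  ext l
  simp only [Pi.sub_apply, Pi.smul_apply, mulVec_diagonal, vechU, of_apply, smul_eq_mul,
    Real.mul_self_sqrt (hw _).le]
  ring

/-! ### Stochastic boundedness and convergence in probability -/

section StochasticOrder

variable {Ω : Type*} [MeasurableSpace Ω] {P : Measure Ω}

lemma tendstoInMeasure_zero_iff {E : Type*} [NormedAddCommGroup E] {f : ℕ → Ω → E} :
    TendstoInMeasure P f atTop (fun _ => 0) ↔
      ∀ ε : ℝ, 0 < ε → ∀ δ : ENNReal, 0 < δ → ∀ᶠ n in atTop, P {ω | ε ≤ ‖f n ω‖} ≤ δ := by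
  simp [tendstoInMeasure_iff_norm, ENNReal.tendsto_nhds_zero]

lemma tendstoInMeasure_zero_of_norm_le {E F : Type*} [NormedAddCommGroup E] [NormedAddCommGroup F]
    {f : ℕ → Ω → E} {g : ℕ → Ω → F} (hg : TendstoInMeasure P g atTop (fun _ => 0))
    (hfg : ∀ᶠ n in atTop, ∀ ω, ‖f n ω‖ ≤ ‖g n ω‖) :
    TendstoInMeasure P f atTop (fun _ => 0) := by
  rw [tendstoInMeasure_zero_iff] at hg ⊢
  intro ε hε δ hδ
  filter_upwards [hg ε hε δ hδ, hfg] with n hn hle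
  exact (measure_mono fun ω (hω : ε ≤ ‖f n ω‖) => hω.trans (hle ω)).trans hn

lemma tendstoInMeasure_zero_add {E : Type*} [NormedAddCommGroup E] {f g : ℕ → Ω → E}
    (hf : TendstoInMeasure P f atTop (fun _ => 0)) (hg : TendstoInMeasure P g atTop (fun _ => 0)) :
    TendstoInMeasure P (fun n ω => f n ω + g n ω) atTop (fun _ => 0) := by
  rw [tendstoInMeasure_zero_iff] at hf hg ⊢
  intro ε hε δ hδ
  filter_upwards [hf (ε / 2) (half_pos hε) (δ / 2) (ENNReal.half_pos hδ.ne'),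
    hg (ε / 2) (half_pos hε) (δ / 2) (ENNReal.half_pos hδ.ne')] with n hfn hgn
  rw [← ENNReal.add_halves δ]
  refine (measure_mono ?_).trans ((measure_union_le _ _).trans (add_le_add hfn hgn))
  intro ω (hω : ε ≤ ‖f n ω + g n ω‖)
  by_contra hc
  simp only [Set.mem_union, Set.mem_ofPred_eq, not_or, not_le] at hc
  linarith [norm_add_le (f n ω) (g n ω)]

lemma tendstoInMeasure_zero_const {E : Type*} [NormedAddCommGroup E] :
    TendstoInMeasure P (fun (_ : ℕ) (_ : Ω) => (0 : E)) atTop (fun _ => 0) := by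
  rw [tendstoInMeasure_zero_iff]
  intro ε hε δ _
  simp [not_le.2 hε]

lemma tendstoInMeasure_zero_sum {E ι : Type*} [NormedAddCommGroup E] (s : Finset ι)
    {f : ι → ℕ → Ω → E} (hf : ∀ i ∈ s, TendstoInMeasure P (f i) atTop (fun _ => 0)) :
    TendstoInMeasure P (fun n ω => ∑ i ∈ s, f i n ω) atTop (fun _ => 0) := by
  classical
  induction s using Finset.induction_on with
  | empty => simpa using tendstoInMeasure_zero_const
  | insert i s hi ih =>
    simp_rw [Finset.sum_insert hi]
    exact tendstoInMeasure_zero_add (hf i (Finset.mem_insert_self i s))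
      (ih fun j hj => hf j (Finset.mem_insert_of_mem hj))

lemma tendstoInMeasure_zero_const_mul {f : ℕ → Ω → ℝ}
    (hf : TendstoInMeasure P f atTop (fun _ => 0)) (c : ℝ) :
    TendstoInMeasure P (fun n ω => c * f n ω) atTop (fun _ => 0) := by
  rw [tendstoInMeasure_zero_iff] at hf ⊢
  intro ε hε δ hδ
  have hc : 0 < |c| + 1 := by positivity
  filter_upwards [hf (ε / (|c| + 1)) (div_pos hε hc) δ hδ] with n hn
  refine (measure_mono fun ω (hω : ε ≤ ‖c * f n ω‖) => ?_).trans hn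
  rw [norm_mul, Real.norm_eq_abs c] at hω
  exact (div_le_iff₀' hc).2 (by linarith [norm_nonneg (f n ω)])

lemma tendstoInMeasure_zero_toLp {ι : Type*} [Fintype ι] {f : ℕ → Ω → ι → ℝ}
    (hf : ∀ i, TendstoInMeasure P (fun n ω => f n ω i) atTop (fun _ => 0)) :
    TendstoInMeasure P (fun n ω => WithLp.toLp 2 (f n ω)) atTop
      (fun _ => (0 : EuclideanSpace ℝ ι)) := by
  have h := tendstoInMeasure_zero_sum (P := P) Finset.univ
    (f := fun i n ω => ‖f n ω i‖) fun i _ =>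
      tendstoInMeasure_zero_of_norm_le (hf i) (by simp)
  refine tendstoInMeasure_zero_of_norm_le h (.of_forall fun n ω => ?_)
  rw [Real.norm_of_nonneg (Finset.sum_nonneg fun _ _ => norm_nonneg _), EuclideanSpace.norm_eq]
  refine Real.sqrt_le_iff.2 ⟨Finset.sum_nonneg fun _ _ => norm_nonneg _, ?_⟩
  exact Finset.sum_sq_le_sq_sum_of_nonneg fun _ _ => norm_nonneg _

/-- `Y n = O_P(1)`: the sequence `Y` is bounded in probability. -/
def BoundedInProbability (P : Measure Ω) (Y : ℕ → Ω → ℝ) : Prop :=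
  ∀ δ : ENNReal, 0 < δ → ∃ C : ℝ, ∀ᶠ n in atTop, P {ω | C ≤ |Y n ω|} ≤ δ

lemma BoundedInProbability.of_tendstoInMeasure {Y : ℕ → Ω → ℝ}
    (hY : TendstoInMeasure P Y atTop (fun _ => 0)) : BoundedInProbability P Y :=
  fun δ hδ => ⟨1, tendstoInMeasure_zero_iff.1 hY 1 one_pos δ hδ⟩

lemma boundedInProbability_const (c : ℝ) : BoundedInProbability P (fun _ _ => c) := by
  intro δ _
  have : {_ω : Ω | |c| + 1 ≤ |c|} = ∅ := by ext; simp
  exact ⟨|c| + 1, .of_forall fun n => by rw [this]; simp⟩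

lemma BoundedInProbability.mono {Y Z : ℕ → Ω → ℝ} (hZ : BoundedInProbability P Z)
    (h : ∀ n ω, |Y n ω| ≤ |Z n ω|) : BoundedInProbability P Y := by
  intro δ hδ
  obtain ⟨C, hC⟩ := hZ δ hδ
  refine ⟨C, hC.mono fun n hn => (measure_mono fun ω (hω : C ≤ |Y n ω|) => ?_).trans hn⟩
  exact hω.trans (h n ω)

lemma BoundedInProbability.add {Y Z : ℕ → Ω → ℝ} (hY : BoundedInProbability P Y)
    (hZ : BoundedInProbability P Z) : BoundedInProbability P (fun n ω => Y n ω + Z n ω) := by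
  intro δ hδ
  obtain ⟨C, hC⟩ := hY (δ / 2) (ENNReal.half_pos hδ.ne')
  obtain ⟨D, hD⟩ := hZ (δ / 2) (ENNReal.half_pos hδ.ne')
  refine ⟨C + D, ?_⟩
  filter_upwards [hC, hD] with n hCn hDn
  rw [← ENNReal.add_halves δ]
  refine (measure_mono ?_).trans ((measure_union_le _ _).trans (add_le_add hCn hDn))
  intro ω (hω : C + D ≤ |Y n ω + Z n ω|)
  by_contra hc
  simp only [Set.mem_union, Set.mem_ofPred_eq, not_or, not_le] at hc
  linarith [abs_add_le (Y n ω) (Z n ω)]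

lemma BoundedInProbability.mul {Y Z : ℕ → Ω → ℝ} (hY : BoundedInProbability P Y)
    (hZ : BoundedInProbability P Z) : BoundedInProbability P (fun n ω => Y n ω * Z n ω) := by
  intro δ hδ
  obtain ⟨C, hC⟩ := hY (δ / 2) (ENNReal.half_pos hδ.ne')
  obtain ⟨D, hD⟩ := hZ (δ / 2) (ENNReal.half_pos hδ.ne')
  refine ⟨C * D, ?_⟩
  filter_upwards [hC, hD] with n hCn hDn
  rw [← ENNReal.add_halves δ]
  refine (measure_mono ?_).trans ((measure_union_le _ _).trans (add_le_add hCn hDn))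
  intro ω (hω : C * D ≤ |Y n ω * Z n ω|)
  by_contra hc
  simp only [Set.mem_union, Set.mem_ofPred_eq, not_or, not_le] at hc
  rw [abs_mul] at hω
  exact absurd hω (not_le.2 (mul_lt_mul'' hc.1 hc.2 (abs_nonneg _) (abs_nonneg _)))

lemma BoundedInProbability.tendstoInMeasure_mul {Y : ℕ → Ω → ℝ} (hY : BoundedInProbability P Y)
    {c : ℕ → ℝ} (hc : Tendsto c atTop (𝓝 0)) :
    TendstoInMeasure P (fun n ω => c n * Y n ω) atTop (fun _ => 0) := by
  rw [tendstoInMeasure_zero_iff]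
  intro ε hε δ hδ
  obtain ⟨C, hC⟩ := hY δ hδ
  have h0 : Tendsto (fun n => |c n| * |C|) atTop (𝓝 0) := by
    simpa using hc.abs.mul_const |C|
  filter_upwards [hC, h0.eventually_lt_const hε] with n hn hlt
  refine (measure_mono fun ω (hω : ε ≤ ‖c n * Y n ω‖) => ?_).trans hn
  by_contra hcon
  have h1 : |Y n ω| ≤ |C| := (not_le.1 hcon).le.trans (le_abs_self C)
  rw [Real.norm_eq_abs, abs_mul] at hω
  linarith [mul_le_mul_of_nonneg_left h1 (abs_nonneg (c n))]

/-- The delta method as an expansion in probability: if `√n (T n - v)` is bounded in probability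
and `g` is differentiable at `v`, then `√n (g (T n) - g v)` differs from the derivative at
`√n (T n - v)` by a term that tends to zero in probability. -/
lemma tendstoInMeasure_delta_method {E : Type*} [NormedAddCommGroup E] [NormedSpace ℝ E]
    {T : ℕ → Ω → E} {v : E} {g : E → ℝ} {g' : E →L[ℝ] ℝ} (hg : HasFDerivAt g g' v)
    (hT : BoundedInProbability P fun (n : ℕ) ω => √(n : ℝ) * ‖T n ω - v‖) :
    TendstoInMeasure P
      (fun (n : ℕ) ω => √(n : ℝ) * (g (T n ω) - g v) - g' (√(n : ℝ) • (T n ω - v)))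
      atTop (fun _ => 0) := by
  rw [tendstoInMeasure_zero_iff]
  intro ε hε δ hδ
  obtain ⟨C₀, hC₀⟩ := hT δ hδ
  set C := max C₀ 1 with hCdef
  have hC : 0 < C := lt_of_lt_of_le one_pos (le_max_right _ _)
  obtain ⟨η, hη, hball⟩ := Metric.eventually_nhds_iff.1
    (hg.isLittleO.def (div_pos hε hC))
  have hsqrt : Tendsto (fun n : ℕ => √(n : ℝ)) atTop atTop :=
    Real.tendsto_sqrt_atTop.comp tendsto_natCast_atTop_atTop
  filter_upwards [hC₀, hsqrt.eventually_ge_atTop (C / η), hsqrt.eventually_gt_atTop 0]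
    with n hn hnη hpos
  refine (measure_mono fun ω hω => ?_).trans hn
  simp only [Set.mem_ofPred_eq] at hω ⊢
  by_contra hcon
  rw [not_le, abs_of_nonneg (by positivity)] at hcon
  have hlt : √(n : ℝ) * ‖T n ω - v‖ < C := hcon.trans_le (le_max_left _ _)
  have hd : dist (T n ω) v < η := by
    rw [dist_eq_norm]
    have h1 : C ≤ √(n : ℝ) * η := (div_le_iff₀ hη).1 hnη
    exact lt_of_mul_lt_mul_left (hlt.trans_le h1) hpos.le
  have hrem := hball hd
  have heq : √(n : ℝ) * (g (T n ω) - g v) - g' (√(n : ℝ) • (T n ω - v))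
      = √(n : ℝ) * (g (T n ω) - g v - g' (T n ω - v)) := by
    rw [map_smul, smul_eq_mul]; ring
  rw [heq, norm_mul, Real.norm_of_nonneg hpos.le] at hω
  have h2 : √(n : ℝ) * ‖g (T n ω) - g v - g' (T n ω - v)‖
      ≤ ε / C * (√(n : ℝ) * ‖T n ω - v‖) := by
    calc _ ≤ √(n : ℝ) * (ε / C * ‖T n ω - v‖) := mul_le_mul_of_nonneg_left hrem hpos.le
      _ = _ := by ring
  have h3 : ε / C * (√(n : ℝ) * ‖T n ω - v‖) < ε / C * C :=
    mul_lt_mul_of_pos_left hlt (div_pos hε hC)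
  rw [div_mul_cancel₀ _ hC.ne'] at h3
  linarith

/-- Normalized sums of square integrable i.i.d. variables are bounded in probability, by
Chebyshev's inequality. -/
lemma boundedInProbability_inv_sqrt_mul_sum [IsProbabilityMeasure P] {Y : ℕ → Ω → ℝ}
    (hY : MemLp (Y 0) 2 P) (hindep : iIndepFun Y P)
    (hident : ∀ k, IdentDistrib (Y k) (Y 0) P P) :
    BoundedInProbability P fun (n : ℕ) ω =>
      (√(n : ℝ))⁻¹ * (∑ k ∈ Finset.range n, Y k ω - n * P[Y 0]) := by
  have hmem : ∀ k, MemLp (Y k) 2 P := fun k => (hident k).memLp_iff.2 hY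
  have hvar : ∀ n : ℕ, Var[∑ k ∈ Finset.range n, Y k; P] = n * Var[Y 0; P] := by
    intro n
    rw [IndepFun.variance_sum (fun k _ => hmem k) (fun i _ j _ hij => hindep.indepFun hij)]
    simp [fun k => (hident k).variance_eq]
  have hmean : ∀ n : ℕ, ∫ ω, (∑ k ∈ Finset.range n, Y k) ω ∂P = n * ∫ ω, Y 0 ω ∂P := by
    intro n
    simp only [Finset.sum_apply]
    rw [integral_finsetSum _ fun k _ => (hmem k).integrable (by norm_num)]
    simp [fun k => (hident k).integral_eq]
  intro δ hδ
  have hlim : Tendsto (fun C : ℝ => ENNReal.ofReal (Var[Y 0; P] / C ^ 2)) atTop (𝓝 0) := by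
    have := ENNReal.tendsto_ofReal
      ((tendsto_const_nhds (x := Var[Y 0; P])).div_atTop (tendsto_pow_atTop two_ne_zero))
    simpa using this
  obtain ⟨C, hCδ, hC⟩ := ((hlim.eventually_le_const hδ).and (eventually_gt_atTop 0)).exists
  refine ⟨C, ?_⟩
  filter_upwards [eventually_gt_atTop 0] with n hn
  have hn' : (0 : ℝ) < n := by exact_mod_cast hn
  have hs : 0 < √(n : ℝ) := Real.sqrt_pos.2 hn'
  have hcheb := meas_ge_le_variance_div_sq
    (memLp_finsetSum' (Finset.range n) fun k _ => hmem k) (mul_pos hC hs)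
  rw [hvar, hmean, mul_pow, Real.sq_sqrt hn'.le, mul_comm (n : ℝ) (Var[Y 0; P]),
    mul_div_mul_right _ _ hn'.ne'] at hcheb
  refine (measure_mono fun ω hω => ?_).trans (hcheb.trans hCδ)
  simp only [Set.mem_ofPred_eq, Finset.sum_apply] at hω ⊢
  rwa [abs_mul, abs_of_pos (inv_pos.2 hs), le_inv_mul_iff₀' hs] at hω

end StochasticOrder

/-! ### Independence of blocks -/

/-- Disjoint blocks of an independent family are independent. -/
lemma iIndepFun_curry {Ω ι κ E : Type*} [MeasurableSpace Ω] [MeasurableSpace E] {P : Measure Ω}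
    [Countable ι] [Countable κ] {X : ι × κ → Ω → E} (hX : ∀ p, AEMeasurable (X p) P)
    (h : iIndepFun X P) : iIndepFun (fun i ω k => X (i, k) ω) P := by
  have := h.isProbabilityMeasure
  have : ∀ i k, IsProbabilityMeasure (P.map (X (i, k))) := fun i k =>
    Measure.isProbabilityMeasure_map (hX _)
  rw [iIndepFun_iff_map_fun_eq_infinitePi_map₀' fun i => aemeasurable_pi_iff.2 fun k => hX _]
  have hrow : ∀ i, P.map (fun ω k => X (i, k) ω) = Measure.infinitePi fun k => P.map (X (i, k)) :=
    fun i => (h.precomp (g := fun k => (i, k)) fun _ _ hk => by simpa using hk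
      ).map_fun_eq_infinitePi_map₀' fun k => hX _
  simp_rw [hrow]
  rw [← Measure.infinitePi_map_curry fun i k => P.map (X (i, k)),
    ← h.map_fun_eq_infinitePi_map₀' hX, AEMeasurable.map_map_of_aemeasurable (by fun_prop)
      (aemeasurable_pi_iff.2 hX)]
  rfl

/-! ### The multivariate central limit theorem -/

section CentralLimit

variable {Ω : Type*} [MeasurableSpace Ω] {P : Measure Ω} {ι κ : Type*} [Fintype ι] [Fintype κ]

lemma dotProduct_covMat_mulVec [IsFiniteMeasure P] {Y : Ω → ι → ℝ}
    (hY : ∀ q, MemLp (fun ω => Y ω q) 2 P) (u : ι → ℝ) :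
    u ⬝ᵥ covMat Y P *ᵥ u = Var[fun ω => u ⬝ᵥ Y ω; P] := by
  simp only [dotProduct, mulVec]
  rw [variance_fun_sum fun q => (hY q).const_mul (u q)]
  refine Finset.sum_congr rfl fun i _ => ?_
  rw [Finset.mul_sum]
  refine Finset.sum_congr rfl fun j _ => ?_
  rw [covariance_const_mul_left, covariance_const_mul_right, covMat, of_apply]
  ring

lemma posSemidef_covMat [IsFiniteMeasure P] {Y : Ω → ι → ℝ}
    (hY : ∀ q, MemLp (fun ω => Y ω q) 2 P) : (covMat Y P).PosSemidef := by
  refine .of_dotProduct_mulVec_nonneg ?_ fun u => ?_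
  · ext i j
    simp [covMat, covariance_comm]
  · rw [star_trivial, dotProduct_covMat_mulVec hY]
    exact variance_nonneg _ _

/-- The characteristic function of a random vector, read off from its scalar projections. -/
lemma charFun_map_eq_charFun_map_dotProduct {W : Ω → ι → ℝ}
    (hW : ∀ i, AEMeasurable (fun ω => W ω i) P) (s : EuclideanSpace ℝ ι) :
    charFun (P.map fun ω => WithLp.toLp 2 (W ω)) s = charFun (P.map fun ω => s.ofLp ⬝ᵥ W ω) 1 := by
  have h1 : AEMeasurable (fun ω => (WithLp.toLp 2 (W ω) : EuclideanSpace ℝ ι)) P :=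
    (WithLp.measurable_toLp 2 (ι → ℝ)).comp_aemeasurable (aemeasurable_pi_iff.2 hW)
  have h2 : AEMeasurable (fun ω => s.ofLp ⬝ᵥ W ω) P :=
    Finset.aemeasurable_fun_sum _ fun i _ => (hW i).const_mul _
  rw [charFun_apply, charFun_apply, integral_map h1 (by fun_prop), integral_map h2 (by fun_prop)]
  simp [PiLp.inner_apply, dotProduct]

/-- Linear images of the multivariate central limit theorem, reduced to the theorem on the line by
the Cramér–Wold device. -/
lemma tendstoInDistribution_mulVec_inv_sqrt_mul_sum [IsProbabilityMeasure P] [DecidableEq κ]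
    {Y : ℕ → Ω → ι → ℝ} (hindep : iIndepFun Y P) (hident : ∀ k, IdentDistrib (Y k) (Y 0) P P)
    (hY : ∀ q, MemLp (fun ω => Y 0 ω q) 2 P) (M : Matrix κ ι ℝ) :
    TendstoInDistribution
      (fun (n : ℕ) ω => WithLp.toLp 2 (M *ᵥ fun q =>
        (√(n : ℝ))⁻¹ * (∑ k ∈ Finset.range n, Y k ω q - n * ∫ ω, Y 0 ω q ∂P)))
      atTop (id : EuclideanSpace ℝ κ → EuclideanSpace ℝ κ) (fun _ => P)
      (multivariateGaussian 0 (M * covMat (Y 0) P * Mᵀ)) := by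
  have hmeas : ∀ k q, AEMeasurable (fun ω => Y k ω q) P := fun k q =>
    (measurable_pi_apply q).comp_aemeasurable (hident k).aemeasurable_fst
  have hcoord : ∀ (n : ℕ) (l : κ), AEMeasurable (fun ω => (M *ᵥ fun q =>
      (√(n : ℝ))⁻¹ * (∑ k ∈ Finset.range n, Y k ω q - n * ∫ ω, Y 0 ω q ∂P)) l) P := fun n l =>
    Finset.aemeasurable_fun_sum _ fun q _ => (((Finset.aemeasurable_fun_sum _ fun k _ =>
      hmeas k q).sub_const _).const_mul _).const_mul _
  have hpsd : (M * covMat (Y 0) P * Mᵀ).PosSemidef := by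
    simpa using (posSemidef_covMat hY).mul_mul_conjTranspose_same M
  refine ⟨fun n => (WithLp.measurable_toLp 2 (κ → ℝ)).comp_aemeasurable
    (aemeasurable_pi_iff.2 (hcoord n)), aemeasurable_id, ?_⟩
  refine ProbabilityMeasure.tendsto_iff_tendsto_charFun.2 fun s => ?_
  set u : ι → ℝ := Mᵀ *ᵥ s.ofLp with hu
  have hmeasu : Measurable fun y : ι → ℝ => u ⬝ᵥ y :=
    Finset.measurable_fun_sum _ fun q _ => (measurable_pi_apply q).const_mul _
  have hmemu : MemLp (fun ω => u ⬝ᵥ Y 0 ω) 2 P := memLp_finsetSum _ fun q _ => (hY q).const_mul _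
  have hclt := tendstoInDistribution_inv_sqrt_mul_sum_sub
    (X := fun k ω => u ⬝ᵥ Y k ω) (Y := id) (P := P)
    (P' := gaussianReal 0 Var[fun ω => u ⬝ᵥ Y 0 ω; P].toNNReal) HasLaw.id hmemu
    (hindep.comp (fun _ y => u ⬝ᵥ y) fun _ => hmeasu) (fun k => (hident k).comp hmeasu)
  have hlim := ProbabilityMeasure.tendsto_iff_tendsto_charFun.1 hclt.tendsto 1
  simp only [ProbabilityMeasure.coe_mk, Measure.map_id] at hlim ⊢
  rw [charFun_multivariateGaussian hpsd]
  rw [charFun_gaussianReal, Real.coe_toNNReal _ (variance_nonneg _ _),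
    ← dotProduct_covMat_mulVec hY] at hlim
  have hquad : u ⬝ᵥ covMat (Y 0) P *ᵥ u = s.ofLp ⬝ᵥ (M * covMat (Y 0) P * Mᵀ) *ᵥ s.ofLp := by
    rw [hu, ← mulVec_mulVec, ← mulVec_mulVec, mulVec_transpose, dotProduct_mulVec,
      ← dotProduct_mulVec, dotProduct_mulVec s.ofLp M]
  rw [hquad] at hlim
  have hfun : ∀ n : ℕ, (fun ω => s.ofLp ⬝ᵥ (M *ᵥ fun q =>
      (√(n : ℝ))⁻¹ * (∑ k ∈ Finset.range n, Y k ω q - n * ∫ ω, Y 0 ω q ∂P)))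
      = fun ω => (√(n : ℝ))⁻¹ *
        (∑ k ∈ Finset.range n, u ⬝ᵥ Y k ω - n * ∫ ω, u ⬝ᵥ Y 0 ω ∂P) := by
    intro n
    have hint : ∫ ω, u ⬝ᵥ Y 0 ω ∂P = ∑ q, u q * ∫ ω, Y 0 ω q ∂P := by
      simp only [dotProduct]
      rw [integral_finsetSum _ fun q _ => ((hY q).integrable (by norm_num)).const_mul _]
      simp_rw [integral_const_mul]
    ext ω
    rw [dotProduct_mulVec, ← mulVec_transpose, ← hu, hint]
    simp only [dotProduct]
    rw [Finset.sum_comm, Finset.mul_sum, ← Finset.sum_sub_distrib, Finset.mul_sum]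
    refine Finset.sum_congr rfl fun q _ => ?_
    rw [← Finset.mul_sum]
    ring
  simp_rw [charFun_map_eq_charFun_map_dotProduct (hcoord _), hfun]
  simpa using hlim

end CentralLimit

/-! ### The empirical covariance matrix of a centered i.i.d. sequence -/

section SingleGroup

variable {Ω : Type*} [MeasurableSpace Ω] {P : Measure Ω} {d : ℕ}
  {ε : ℕ → Ω → EuclideanSpace ℝ (Fin d)}

/-- The errors of one group: an i.i.d. sequence of centered random vectors with finite fourth
moments. -/
structure IsCenteredIID (ε : ℕ → Ω → EuclideanSpace ℝ (Fin d)) (P : Measure Ω) : Prop where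
  indep : iIndepFun ε P
  ident : ∀ k, IdentDistrib (ε k) (ε 0) P P
  mean : ∫ ω, ε 0 ω ∂P = 0
  memLp : MemLp (ε 0) 4 P

/-- The main part of `√n (V̂ - V)`: the matrix with the entries
`n^{-1/2} ∑_{m < n} (x_{mj} x_{mk} - V_{jk})`, in which the observations are not centered at their
empirical mean. -/
noncomputable def normalizedSecondMoments (V : Matrix (Fin d) (Fin d) ℝ)
    (x : ℕ → EuclideanSpace ℝ (Fin d)) (n : ℕ) : Matrix (Fin d) (Fin d) ℝ :=
  Matrix.of fun j k => (√(n : ℝ))⁻¹ * (∑ m ∈ Finset.range n, x m j * x m k - n * V j k)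

lemma sampleCov_add_const (c : EuclideanSpace ℝ (Fin d)) (x : ℕ → EuclideanSpace ℝ (Fin d))
    (n : ℕ) : sampleCov (fun k => c + x k) n = sampleCov x n := by
  rcases Nat.eq_zero_or_pos n with rfl | hn
  · ext; simp [sampleCov]
  have hn' : (n : ℝ) ≠ 0 := by positivity
  have hmean : sampleMean (fun k => c + x k) n = c + sampleMean x n := by
    rw [sampleMean, Finset.sum_add_distrib, smul_add, sampleMean]
    simp [← Nat.cast_smul_eq_nsmul ℝ, smul_smul, inv_mul_cancel₀ hn']
  ext j k
  simp [sampleCov, hmean]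

lemma sampleCov_apply_eq (x : ℕ → EuclideanSpace ℝ (Fin d)) {n : ℕ} (hn : n ≠ 0) (j k : Fin d) :
    sampleCov x n j k = ((n : ℝ) - 1)⁻¹ * (∑ m ∈ Finset.range n, x m j * x m k
      - (n : ℝ)⁻¹ * (∑ m ∈ Finset.range n, x m j) * ∑ m ∈ Finset.range n, x m k) := by
  have hn' : (n : ℝ) ≠ 0 := by exact_mod_cast hn
  have hmean : ∀ i, sampleMean x n i = (n : ℝ)⁻¹ * ∑ m ∈ Finset.range n, x m i := by
    intro i; simp [sampleMean]
  simp only [sampleCov, of_apply, hmean]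
  congr 1
  simp only [sub_mul, mul_sub, Finset.sum_sub_distrib, ← Finset.mul_sum, ← Finset.sum_mul,
    Finset.sum_const, Finset.card_range, nsmul_eq_mul]
  field_simp
  ring

/-- The expansion of `√n (V̂ - V)`: its main part, and three terms that vanish in the limit. -/
lemma sqrt_mul_sampleCov_sub (V : Matrix (Fin d) (Fin d) ℝ) (x : ℕ → EuclideanSpace ℝ (Fin d))
    {n : ℕ} (hn : 1 < n) (j k : Fin d) :
    √(n : ℝ) * (sampleCov x n j k - V j k) - normalizedSecondMoments V x n j k
      = ((n : ℝ) - 1)⁻¹ * normalizedSecondMoments V x n j k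
        + √(n : ℝ) * ((n : ℝ) - 1)⁻¹ * V j k
        + -(√(n : ℝ) * ((n : ℝ) - 1)⁻¹) * (((√(n : ℝ))⁻¹ * ∑ m ∈ Finset.range n, x m j)
          * ((√(n : ℝ))⁻¹ * ∑ m ∈ Finset.range n, x m k)) := by
  have h1 : (1 : ℝ) < n := by exact_mod_cast hn
  have h2 : (n : ℝ) - 1 ≠ 0 := by linarith
  have hs : √(n : ℝ) ≠ 0 := (Real.sqrt_pos.2 (by linarith)).ne'
  rw [sampleCov_apply_eq x (by omega)]
  simp only [normalizedSecondMoments, of_apply]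
  generalize (∑ m ∈ Finset.range n, x m j * x m k) = Q
  generalize (∑ m ∈ Finset.range n, x m j) = S
  generalize (∑ m ∈ Finset.range n, x m k) = T
  generalize hsn : √(n : ℝ) = s at *
  have hn2 : (n : ℝ) = s ^ 2 := by rw [← hsn, Real.sq_sqrt (by linarith)]
  rw [hn2] at h2 ⊢
  field_simp
  ring

namespace IsCenteredIID

lemma measurable_coord (j : Fin d) : Measurable fun x : EuclideanSpace ℝ (Fin d) => x j := by
  fun_prop

lemma memLp_coord (h : IsCenteredIID ε P) (j : Fin d) : MemLp (fun ω => ε 0 ω j) 4 P :=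
  h.memLp.eval_piLp j

lemma aemeasurable_coord (h : IsCenteredIID ε P) (k : ℕ) (j : Fin d) :
    AEMeasurable (fun ω => ε k ω j) P :=
  (measurable_coord j).comp_aemeasurable (h.ident k).aemeasurable_fst

lemma memLp_mul (h : IsCenteredIID ε P) (j k : Fin d) :
    MemLp (fun ω => ε 0 ω j * ε 0 ω k) 2 P := by
  have : ENNReal.HolderTriple 4 4 2 := ⟨by
    rw [show (4 : ENNReal) = 2 * 2 by norm_num, ENNReal.mul_inv (by simp) (by simp), ← mul_add,
      ENNReal.inv_two_add_inv_two, mul_one]⟩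
  exact (h.memLp_coord k).mul (h.memLp_coord j)

lemma aemeasurable_sampleCov (h : IsCenteredIID ε P) (n : ℕ) (j k : Fin d) :
    AEMeasurable (fun ω => sampleCov (fun m => ε m ω) n j k) P := by
  have hmean : ∀ i, AEMeasurable (fun ω => sampleMean (fun m => ε m ω) n i) P := by
    intro i
    have : (fun ω => sampleMean (fun m => ε m ω) n i)
        = fun ω => (n : ℝ)⁻¹ * ∑ m ∈ Finset.range n, ε m ω i := by
      ext ω; simp [sampleMean]
    rw [this]
    exact (Finset.aemeasurable_fun_sum _ fun m _ => h.aemeasurable_coord m i).const_mul _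
  exact (Finset.aemeasurable_fun_sum _ fun m _ => ((h.aemeasurable_coord m j).sub (hmean j)).mul
    ((h.aemeasurable_coord m k).sub (hmean k))).const_mul _

lemma aemeasurable_corrDiff (h : IsCenteredIID ε P) (V : Matrix (Fin d) (Fin d) ℝ) (n : ℕ)
    (l : Fin (dimPu d)) : AEMeasurable (fun ω => corrDiff V (fun m => ε m ω) n l) P := by
  refine AEMeasurable.sub_const ?_ _
  exact (h.aemeasurable_sampleCov n _ _).div ((h.aemeasurable_sampleCov n _ _).sqrt.mul
    (h.aemeasurable_sampleCov n _ _).sqrt)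

lemma memLp_vech (h : IsCenteredIID ε P) (q : Fin (dimP d)) :
    MemLp (fun ω => vech (vecMulVec (fun j => ε 0 ω j) (fun k => ε 0 ω k)) q) 2 P :=
  h.memLp_mul _ _

variable [IsProbabilityMeasure P]

lemma integral_coord (h : IsCenteredIID ε P) (j : Fin d) : ∫ ω, ε 0 ω j ∂P = 0 := by
  rw [← eval_integral_piLp fun i => (h.memLp_coord i).integrable (by norm_num), h.mean]
  simp

lemma integral_mul (h : IsCenteredIID ε P) (j k : Fin d) :
    ∫ ω, ε 0 ω j * ε 0 ω k ∂P = popCov (ε 0) P j k := by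
  have h2 : ∀ j, MemLp (fun ω => ε 0 ω j) 2 P := fun j =>
    (h.memLp_coord j).mono_exponent (by norm_num)
  rw [popCov, covMat, of_apply, covariance_eq_sub (h2 j) (h2 k)]
  simp [h.integral_coord]

lemma boundedInProbability_sum (h : IsCenteredIID ε P) (j : Fin d) :
    BoundedInProbability P fun (n : ℕ) ω => (√(n : ℝ))⁻¹ * ∑ m ∈ Finset.range n, ε m ω j := by
  have := boundedInProbability_inv_sqrt_mul_sum (P := P) (Y := fun m ω => ε m ω j)
    ((h.memLp_coord j).mono_exponent (by norm_num))
    (h.indep.comp (fun _ x => x j) fun _ => measurable_coord j)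
    (fun m => (h.ident m).comp (measurable_coord j))
  simpa [h.integral_coord] using this

lemma boundedInProbability_normalizedSecondMoments (h : IsCenteredIID ε P) (j k : Fin d) :
    BoundedInProbability P fun (n : ℕ) ω =>
      normalizedSecondMoments (popCov (ε 0) P) (fun m => ε m ω) n j k := by
  have hmeas : Measurable fun x : EuclideanSpace ℝ (Fin d) => x j * x k := by fun_prop
  have := boundedInProbability_inv_sqrt_mul_sum (P := P) (Y := fun m ω => ε m ω j * ε m ω k)
    (h.memLp_mul j k) (h.indep.comp (fun _ x => x j * x k) fun _ => hmeas)
    (fun m => (h.ident m).comp hmeas)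
  simpa [h.integral_mul, normalizedSecondMoments] using this

lemma tendstoInMeasure_sampleCov_sub (h : IsCenteredIID ε P) (j k : Fin d) :
    TendstoInMeasure P (fun (n : ℕ) ω =>
      √(n : ℝ) * (sampleCov (fun m => ε m ω) n j k - popCov (ε 0) P j k)
        - normalizedSecondMoments (popCov (ε 0) P) (fun m => ε m ω) n j k) atTop (fun _ => 0) := by
  have hinv : Tendsto (fun n : ℕ => ((n : ℝ) - 1)⁻¹) atTop (𝓝 0) :=
    tendsto_inv_atTop_zero.comp
      (tendsto_atTop_add_const_right _ (-1) tendsto_natCast_atTop_atTop)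
  -- `√n / (n - 1)` is at most `2 / √n`
  have hsinv : Tendsto (fun n : ℕ => √(n : ℝ) * ((n : ℝ) - 1)⁻¹) atTop (𝓝 0) := by
    have hup : Tendsto (fun n : ℕ => 2 * (√(n : ℝ))⁻¹) atTop (𝓝 0) := by
      have := (tendsto_inv_atTop_zero.comp
        (Real.tendsto_sqrt_atTop.comp tendsto_natCast_atTop_atTop)).const_mul (2 : ℝ)
      simpa [Function.comp_def] using this
    refine squeeze_zero' ?_ ?_ hup
    · filter_upwards [eventually_ge_atTop 2] with n hn
      have : (2 : ℝ) ≤ n := by exact_mod_cast hn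
      exact mul_nonneg (Real.sqrt_nonneg _) (inv_nonneg.2 (by linarith))
    · filter_upwards [eventually_ge_atTop 2] with n hn
      have h2 : (2 : ℝ) ≤ n := by exact_mod_cast hn
      have hs : 0 < √(n : ℝ) := Real.sqrt_pos.2 (by linarith)
      rw [← div_eq_mul_inv, ← div_eq_mul_inv, div_le_div_iff₀ (by linarith) hs,
        Real.mul_self_sqrt (by linarith)]
      linarith
  have hsum := tendstoInMeasure_zero_add (tendstoInMeasure_zero_add
    ((h.boundedInProbability_normalizedSecondMoments j k).tendstoInMeasure_mul hinv)
    ((boundedInProbability_const (popCov (ε 0) P j k)).tendstoInMeasure_mul hsinv))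
    (((h.boundedInProbability_sum j).mul (h.boundedInProbability_sum k)).tendstoInMeasure_mul
      (by simpa using hsinv.neg))
  refine tendstoInMeasure_zero_of_norm_le hsum ?_
  filter_upwards [eventually_gt_atTop 1] with n hn ω
  rw [sqrt_mul_sampleCov_sub _ _ hn]

lemma boundedInProbability_sampleCov_sub (h : IsCenteredIID ε P) (j k : Fin d) :
    BoundedInProbability P fun (n : ℕ) ω =>
      √(n : ℝ) * (sampleCov (fun m => ε m ω) n j k - popCov (ε 0) P j k) := by
  simpa using (BoundedInProbability.of_tendstoInMeasure (h.tendstoInMeasure_sampleCov_sub j k)).add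
    (h.boundedInProbability_normalizedSecondMoments j k)

end IsCenteredIID

/-! ### The delta method for correlations -/

/-- The correlation as a function of the covariance and the two variances: its derivative, in the
form in which `matM_mulVec_vech` gives the rows of `M(v, r)`. -/
lemma hasFDerivAt_corr {x y z : ℝ} (hy : 0 < y) (hz : 0 < z) :
    ∃ g' : ℝ × ℝ × ℝ →L[ℝ] ℝ,
      HasFDerivAt (fun p : ℝ × ℝ × ℝ => p.1 / (√p.2.1 * √p.2.2)) g' (x, y, z) ∧
      ∀ a b c, g' (a, b, c) = a / (√y * √z) - 1 / 2 * (x / (√y * √z)) * (c / z + b / y) := by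
  have h1 : HasFDerivAt (fun p : ℝ × ℝ × ℝ => p.1)
      (ContinuousLinearMap.fst ℝ ℝ (ℝ × ℝ)) (x, y, z) :=
    hasFDerivAt_fst
  have h2 : HasFDerivAt (fun p : ℝ × ℝ × ℝ => p.2.1) ((ContinuousLinearMap.fst ℝ ℝ ℝ).comp
      (ContinuousLinearMap.snd ℝ ℝ (ℝ × ℝ))) (x, y, z) :=
    hasFDerivAt_fst.comp _ hasFDerivAt_snd
  have h3 : HasFDerivAt (fun p : ℝ × ℝ × ℝ => p.2.2) ((ContinuousLinearMap.snd ℝ ℝ ℝ).comp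
      (ContinuousLinearMap.snd ℝ ℝ (ℝ × ℝ))) (x, y, z) :=
    hasFDerivAt_snd.comp _ hasFDerivAt_snd
  have hsy : √y ≠ 0 := (Real.sqrt_pos.2 hy).ne'
  have hsz : √z ≠ 0 := (Real.sqrt_pos.2 hz).ne'
  have h4 := h1.mul ((hasDerivAt_inv (mul_ne_zero hsy hsz)).comp_hasFDerivAt (x, y, z)
    ((h2.sqrt hy.ne').mul (h3.sqrt hz.ne')))
  refine ⟨_, h4.congr_of_eventuallyEq (.of_forall fun p => div_eq_mul_inv _ _), fun a b c => ?_⟩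
  have ey : √y ^ 2 = y := Real.sq_sqrt hy.le
  have ez : √z ^ 2 = z := Real.sq_sqrt hz.le
  simp only [_root_.add_apply, _root_.smul_apply,
    ContinuousLinearMap.comp_apply, ContinuousLinearMap.coe_fst', ContinuousLinearMap.coe_snd',
    smul_eq_mul, Pi.mul_apply, Function.comp_apply]
  generalize √y = s at *
  generalize √z = t at *
  subst ey ez
  field_simp
  ring

lemma popM_mulVec_vech {V : Matrix (Fin d) (Fin d) ℝ} {Y : Ω → EuclideanSpace ℝ (Fin d)}
    (hV : popCov Y P = V) (hpos : ∀ j, 0 < V j j) (A : Matrix (Fin d) (Fin d) ℝ) :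
    popM Y P *ᵥ vech A = vechU (Matrix.of fun j k => A j k / (√(V j j) * √(V k k))
      - 1 / 2 * corrMat V j k * (A k k / V k k + A j j / V j j)) := by
  subst hV
  exact matM_mulVec_vech _ hpos _ A

lemma covError_eq_vech (V : Matrix (Fin d) (Fin d) ℝ) (x : ℕ → EuclideanSpace ℝ (Fin d)) (n : ℕ) :
    covError V x n = vech (√(n : ℝ) • (sampleCov x n - V)) := rfl

namespace IsCenteredIID

variable [IsProbabilityMeasure P]

/-- The linearization of the empirical correlations. -/
lemma tendstoInMeasure_corrDiff_sub (h : IsCenteredIID ε P)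
    (hvar : ∀ j, 0 < popCov (ε 0) P j j) :
    TendstoInMeasure P (fun (n : ℕ) ω => WithLp.toLp 2
        (√(n : ℝ) • corrDiff (popCov (ε 0) P) (fun k => ε k ω) n
          - popM (ε 0) P *ᵥ covError (popCov (ε 0) P) (fun k => ε k ω) n))
      atTop (fun _ => (0 : EuclideanSpace ℝ (Fin (dimPu d)))) := by
  refine tendstoInMeasure_zero_toLp fun l => ?_
  simp_rw [covError_eq_vech, popM_mulVec_vech rfl hvar]
  set V := popCov (ε 0) P with hV
  set j := (ofLex ((strictUpperPairs d).orderEmbOfFin (card_strictUpperPairs d) l)).1 with hj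
  set k := (ofLex ((strictUpperPairs d).orderEmbOfFin (card_strictUpperPairs d) l)).2 with hk
  obtain ⟨g', hg, hg'⟩ := hasFDerivAt_corr (x := V j k) (hvar j) (hvar k)
  have hT : BoundedInProbability P fun (n : ℕ) ω => √(n : ℝ) *
      ‖((sampleCov (fun m => ε m ω) n j k, sampleCov (fun m => ε m ω) n j j,
        sampleCov (fun m => ε m ω) n k k) : ℝ × ℝ × ℝ) - (V j k, V j j, V k k)‖ := by
    have habs : ∀ j k, BoundedInProbability P fun (n : ℕ) ω =>
        |√(n : ℝ) * (sampleCov (fun m => ε m ω) n j k - V j k)| := fun j k =>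
      (h.boundedInProbability_sampleCov_sub j k).mono fun n ω => by simp [hV]
    refine (((habs j k).add (habs j j)).add (habs k k)).mono fun n ω => ?_
    rw [abs_of_nonneg (by positivity), abs_of_nonneg (by positivity)]
    simp only [abs_mul, abs_of_nonneg (Real.sqrt_nonneg _), ← mul_add]
    refine mul_le_mul_of_nonneg_left ?_ (Real.sqrt_nonneg _)
    simp only [Prod.mk_sub_mk, Prod.norm_mk, Real.norm_eq_abs]
    refine max_le ?_ (max_le ?_ ?_) <;>
    linarith [abs_nonneg (sampleCov (fun m => ε m ω) n j k - V j k),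
      abs_nonneg (sampleCov (fun m => ε m ω) n j j - V j j),
      abs_nonneg (sampleCov (fun m => ε m ω) n k k - V k k)]
  refine tendstoInMeasure_zero_of_norm_le (tendstoInMeasure_delta_method hg hT)
    (.of_forall fun n ω => le_of_eq ?_)
  congr 1
  simp only [Prod.mk_sub_mk, Prod.smul_mk, hg', smul_eq_mul, Pi.sub_apply, Pi.smul_apply, corrDiff,
    vechU, corrMat, of_apply, ← hj, ← hk, Matrix.smul_apply, Matrix.sub_apply]

lemma posSemidef_popUpsilon (h : IsCenteredIID ε P) : (popUpsilon (ε 0) P).PosSemidef := by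
  simpa [popUpsilon, popSigma] using
    (posSemidef_covMat h.memLp_vech).mul_mul_conjTranspose_same (popM (ε 0) P)

/-- Asymptotic normality of the empirical correlations of one group. -/
lemma tendstoInDistribution_corrDiff (h : IsCenteredIID ε P)
    (hvar : ∀ j, 0 < popCov (ε 0) P j j) :
    TendstoInDistribution (fun (n : ℕ) ω => WithLp.toLp 2
        (√(n : ℝ) • corrDiff (popCov (ε 0) P) (fun k => ε k ω) n))
      atTop (id : EuclideanSpace ℝ (Fin (dimPu d)) → EuclideanSpace ℝ (Fin (dimPu d)))
      (fun _ => P) (multivariateGaussian 0 (popUpsilon (ε 0) P)) := by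
  set V := popCov (ε 0) P with hV
  have hmeas : Measurable fun x : EuclideanSpace ℝ (Fin d) =>
      vech (vecMulVec (fun j => x j) (fun k => x k)) := by
    refine measurable_pi_iff.2 fun q => ?_
    exact (measurable_coord _).mul (measurable_coord _)
  have hclt := tendstoInDistribution_mulVec_inv_sqrt_mul_sum (P := P)
    (Y := fun m ω => vech (vecMulVec (fun j => ε m ω j) (fun k => ε m ω k)))
    (h.indep.comp (fun _ x => vech (vecMulVec (fun j => x j) (fun k => x k))) fun _ => hmeas)
    (fun m => (h.ident m).comp hmeas) h.memLp_vech (popM (ε 0) P)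
  have hvec : ∀ (n : ℕ) ω, (fun q => (√(n : ℝ))⁻¹ * (∑ m ∈ Finset.range n,
      vech (vecMulVec (fun j => ε m ω j) (fun k => ε m ω k)) q
        - n * ∫ ω, vech (vecMulVec (fun j => ε 0 ω j) (fun k => ε 0 ω k)) q ∂P))
      = vech (normalizedSecondMoments V (fun m => ε m ω) n) := by
    intro n ω
    ext q
    simp [vech, vecMulVec_apply, h.integral_mul, normalizedSecondMoments, hV]
  simp_rw [hvec] at hclt
  refine tendstoInDistribution_of_tendstoInMeasure_sub _ _ hclt ?_ fun n =>
    (WithLp.measurable_toLp 2 _).comp_aemeasurable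
      (aemeasurable_pi_iff.2 fun l => (h.aemeasurable_corrDiff V n l).const_mul _)
  have hM : TendstoInMeasure P (fun (n : ℕ) ω => WithLp.toLp 2
      (popM (ε 0) P *ᵥ (covError V (fun k => ε k ω) n
        - vech (normalizedSecondMoments V (fun m => ε m ω) n))))
      atTop (fun _ => (0 : EuclideanSpace ℝ (Fin (dimPu d)))) := by
    refine tendstoInMeasure_zero_toLp fun l => ?_
    simp only [mulVec, dotProduct]
    refine tendstoInMeasure_zero_sum Finset.univ fun q _ => ?_
    exact tendstoInMeasure_zero_const_mul (h.tendstoInMeasure_sampleCov_sub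
      (ofLex ((upperPairs d).orderEmbOfFin (card_upperPairs d) q)).1
      (ofLex ((upperPairs d).orderEmbOfFin (card_upperPairs d) q)).2) _
  refine tendstoInMeasure_zero_of_norm_le
    (tendstoInMeasure_zero_add (h.tendstoInMeasure_corrDiff_sub hvar) hM)
    (.of_forall fun n ω => le_of_eq ?_)
  congr 1
  simp only [Pi.sub_apply, mulVec_sub, ← WithLp.toLp_sub, ← WithLp.toLp_add, ← hV]
  congr 1
  abel

end IsCenteredIID

end SingleGroup

/-! ### Independent blocks -/

section Blocks

variable {Ω : Type*} [MeasurableSpace Ω] {P : Measure Ω}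

lemma dotProduct_blockDiagonal'_mulVec {β κ : Type*} [Fintype β] [DecidableEq β] [Fintype κ]
    (S : β → Matrix κ κ ℝ) (x : (_ : β) × κ → ℝ) :
    x ⬝ᵥ blockDiagonal' S *ᵥ x
      = ∑ i, (fun l => x ⟨i, l⟩) ⬝ᵥ S i *ᵥ fun l => x ⟨i, l⟩ := by
  simp only [dotProduct, mulVec, Fintype.sum_sigma]
  refine Finset.sum_congr rfl fun i _ => Finset.sum_congr rfl fun l _ => ?_
  congr 1
  rw [Finset.sum_eq_single i]
  · simp [blockDiagonal'_apply_eq]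
  · intro j _ hj
    simp [blockDiagonal'_apply_ne _ _ _ hj.symm]
  · simp

lemma posSemidef_blockDiagonal' {β κ : Type*} [Fintype β] [DecidableEq β] [Fintype κ]
    {S : β → Matrix κ κ ℝ} (hS : ∀ i, (S i).PosSemidef) : (blockDiagonal' S).PosSemidef := by
  refine .of_dotProduct_mulVec_nonneg ?_ fun x => ?_
  · rw [IsHermitian, blockDiagonal'_conjTranspose]
    congr 1
    ext1 i
    exact (hS i).isHermitian
  · rw [star_trivial, dotProduct_blockDiagonal'_mulVec]
    exact Finset.sum_nonneg fun i _ => by simpa using (hS i).dotProduct_mulVec_nonneg _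

lemma multivariateGaussian_map_smul {κ : Type*} [Fintype κ] [DecidableEq κ] {S : Matrix κ κ ℝ}
    (hS : S.PosSemidef) (c : ℝ) :
    (multivariateGaussian 0 S).map (fun x => c • x) = multivariateGaussian 0 (c ^ 2 • S) := by
  have : IsProbabilityMeasure ((multivariateGaussian 0 S).map (fun x => c • x)) :=
    Measure.isProbabilityMeasure_map (by fun_prop)
  refine Measure.ext_of_charFun (funext fun s => ?_)
  rw [charFun_map_smul, charFun_multivariateGaussian hS,
    charFun_multivariateGaussian (hS.smul (sq_nonneg c))]
  simp only [inner_zero_right, WithLp.ofLp_smul, mulVec_smul, smul_mulVec, dotProduct_smul,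
    smul_dotProduct, smul_eq_mul]
  ring_nf

/-- Slutsky's theorem for deterministic scaling along a subsequence. -/
lemma tendstoInDistribution_smul_comp {κ : Type*} [Fintype κ] [DecidableEq κ]
    [IsProbabilityMeasure P] {Y : ℕ → Ω → EuclideanSpace ℝ κ} {S : Matrix κ κ ℝ}
    (hS : S.PosSemidef)
    (hY : TendstoInDistribution Y atTop (id : EuclideanSpace ℝ κ → EuclideanSpace ℝ κ)
      (fun _ => P) (multivariateGaussian 0 S))
    {n : ℕ → ℕ} (hn : Tendsto n atTop atTop) {c : ℕ → ℝ} {c₀ : ℝ} (hc : Tendsto c atTop (𝓝 c₀)) :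
    TendstoInDistribution (fun t ω => c t • Y (n t) ω) atTop
      (id : EuclideanSpace ℝ κ → EuclideanSpace ℝ κ) (fun _ => P)
      (multivariateGaussian 0 (c₀ ^ 2 • S)) := by
  have hYn : TendstoInDistribution (fun t => Y (n t)) atTop
      (id : EuclideanSpace ℝ κ → EuclideanSpace ℝ κ) (fun _ => P) (multivariateGaussian 0 S) :=
    ⟨fun t => hY.forall_aemeasurable _, hY.aemeasurable_limit, hY.tendsto.comp hn⟩
  have hcm : TendstoInMeasure P (fun t (_ : Ω) => c t) atTop (fun _ => c₀) :=
    tendstoInMeasure_of_tendsto_ae (fun _ => aestronglyMeasurable_const) (.of_forall fun _ => hc)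
  have h := hYn.continuous_comp_prodMk_of_tendstoInMeasure_const
    (g := fun p : EuclideanSpace ℝ κ × ℝ => p.2 • p.1) (by fun_prop) hcm
    (fun _ => aemeasurable_const)
  refine ⟨h.forall_aemeasurable, aemeasurable_id, ?_⟩
  convert h.tendsto using 2
  congr 1
  refine Subtype.ext ?_
  simp [← multivariateGaussian_map_smul hS]

/-- Independent blocks that converge in distribution to normal laws converge jointly, to the normal
law with the block diagonal covariance matrix. -/
lemma tendstoInDistribution_blocks {β κ : Type*} [Fintype β] [DecidableEq β] [Fintype κ]
    [DecidableEq κ] [IsProbabilityMeasure P] {W : ℕ → β → Ω → EuclideanSpace ℝ κ}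
    {S : β → Matrix κ κ ℝ} (hS : ∀ i, (S i).PosSemidef) (hindep : ∀ t, iIndepFun (W t) P)
    (hW : ∀ i, TendstoInDistribution (fun t => W t i) atTop
      (id : EuclideanSpace ℝ κ → EuclideanSpace ℝ κ) (fun _ => P)
      (multivariateGaussian 0 (S i))) :
    TendstoInDistribution
      (fun t ω => WithLp.toLp 2 fun il : (_ : β) × κ => W t il.1 ω il.2) atTop
      (id : EuclideanSpace ℝ ((_ : β) × κ) → EuclideanSpace ℝ ((_ : β) × κ)) (fun _ => P)
      (multivariateGaussian 0 (blockDiagonal' S)) := by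
  have hcoord : ∀ t i l, AEMeasurable (fun ω => W t i ω l) P := fun t i l =>
    (show Measurable fun x : EuclideanSpace ℝ κ => x l by fun_prop).comp_aemeasurable
      ((hW i).forall_aemeasurable t)
  refine ⟨fun t => (WithLp.measurable_toLp 2 _).comp_aemeasurable
    (aemeasurable_pi_iff.2 fun il => hcoord t il.1 il.2), aemeasurable_id, ?_⟩
  refine ProbabilityMeasure.tendsto_iff_tendsto_charFun.2 fun s => ?_
  simp only [ProbabilityMeasure.coe_mk, Measure.map_id]
  set u : β → EuclideanSpace ℝ κ := fun i => WithLp.toLp 2 fun l => s ⟨i, l⟩ with hu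
  have hfac : ∀ t, charFun (P.map fun ω => WithLp.toLp 2 fun il : (_ : β) × κ => W t il.1 ω il.2) s
      = ∏ i, charFun (P.map (W t i)) (u i) := by
    intro t
    have hmeas : ∀ i, Measurable fun x : EuclideanSpace ℝ κ => (u i).ofLp ⬝ᵥ x.ofLp := fun i =>
      Finset.measurable_fun_sum _ fun l _ => by fun_prop
    have hprod := iIndepFun.charFun_map_fun_sum_eq_prod (P := P)
      (X := fun i ω => (u i).ofLp ⬝ᵥ (W t i ω).ofLp)
      (fun i => (hmeas i).comp_aemeasurable ((hW i).forall_aemeasurable t))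
      ((hindep t).comp _ hmeas)
    rw [charFun_map_eq_charFun_map_dotProduct (W := fun ω (il : (_ : β) × κ) => W t il.1 ω il.2)
      fun il => hcoord t il.1 il.2]
    have hsplit : (fun ω => s.ofLp ⬝ᵥ fun il : (_ : β) × κ => W t il.1 ω il.2)
        = fun ω => ∑ i, (u i).ofLp ⬝ᵥ (W t i ω).ofLp := by
      ext ω
      simp [dotProduct, Fintype.sum_sigma, hu]
    rw [hsplit, hprod, Finset.prod_apply]
    exact Finset.prod_congr rfl fun i _ =>
      (charFun_map_eq_charFun_map_dotProduct (fun l => hcoord t i l) (u i)).symm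
  have hlim : charFun (multivariateGaussian 0 (blockDiagonal' S)) s
      = ∏ i, charFun (multivariateGaussian 0 (S i)) (u i) := by
    rw [charFun_multivariateGaussian (posSemidef_blockDiagonal' hS),
      dotProduct_blockDiagonal'_mulVec]
    simp_rw [charFun_multivariateGaussian (hS _)]
    rw [← Complex.exp_sum]
    simp [hu, Finset.sum_div]
  simp_rw [hfac, hlim]
  refine tendsto_finsetProd _ fun i _ => ?_
  simpa using ProbabilityMeasure.tendsto_iff_tendsto_charFun.1 (hW i).tendsto (u i)

end Blocks

/-! ### Asymptotic normality of the pooled correlations -/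

section Pooled

variable {Ω : Type*} [MeasurableSpace Ω] {P : Measure Ω} {a d : ℕ}
  {ε : Fin a → ℕ → Ω → EuclideanSpace ℝ (Fin d)}

lemma iIndepFun_corrDiff (h : ∀ i, IsCenteredIID (ε i) P)
    (hindep : iIndepFun (fun ik : Fin a × ℕ => ε ik.1 ik.2) P)
    (V : Fin a → Matrix (Fin d) (Fin d) ℝ) (c : Fin a → ℝ) (n : Fin a → ℕ) :
    iIndepFun (fun i ω => (WithLp.toLp 2 (c i • corrDiff (V i) (fun k => ε i k ω) (n i)) :
      EuclideanSpace ℝ (Fin (dimPu d)))) P := by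
  have hmeas : ∀ i, Measurable fun x : ℕ → EuclideanSpace ℝ (Fin d) =>
      (WithLp.toLp 2 (c i • corrDiff (V i) x (n i)) : EuclideanSpace ℝ (Fin (dimPu d))) := by
    intro i
    have hcov : ∀ j k, Measurable fun x : ℕ → EuclideanSpace ℝ (Fin d) =>
        sampleCov x (n i) j k := by
      intro j k
      simp only [sampleCov, sampleMean, of_apply]
      fun_prop
    refine (WithLp.measurable_toLp 2 _).comp (measurable_pi_iff.2 fun l => ?_)
    exact (((hcov _ _).div ((hcov _ _).sqrt.mul (hcov _ _).sqrt)).sub_const _).const_mul _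
  exact (iIndepFun_curry (fun p => ((h p.1).ident p.2).aemeasurable_fst) hindep).comp _ hmeas

lemma tendstoInDistribution_pooled_corrDiff [IsProbabilityMeasure P]
    (h : ∀ i, IsCenteredIID (ε i) P)
    (hindep : iIndepFun (fun ik : Fin a × ℕ => ε ik.1 ik.2) P)
    (hvar : ∀ i j, 0 < popCov (ε i 0) P j j) {n : ℕ → Fin a → ℕ} {κ : Fin a → ℝ}
    (hn : ∀ i, Tendsto (fun t => n t i) atTop atTop) (hκ : ∀ i, 0 < κ i)
    (hratio : ∀ i, Tendsto (fun t => (n t i : ℝ) / ((∑ i', n t i' : ℕ) : ℝ)) atTop (𝓝 (κ i))) :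
    TendstoInDistribution
      (fun (t : ℕ) ω => WithLp.toLp 2 (fun il : (_ : Fin a) × Fin (dimPu d) =>
        √((∑ i', n t i' : ℕ) : ℝ) *
          corrDiff (popCov (ε il.1 0) P) (fun k => ε il.1 k ω) (n t il.1) il.2))
      atTop
      (id : EuclideanSpace ℝ ((_ : Fin a) × Fin (dimPu d)) →
        EuclideanSpace ℝ ((_ : Fin a) × Fin (dimPu d)))
      (fun _ => P)
      (multivariateGaussian 0 (blockDiagonal' fun i => (κ i)⁻¹ • popUpsilon (ε i 0) P)) := by
  refine tendstoInDistribution_blocks (W := fun t i ω => WithLp.toLp 2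
      (√((∑ i', n t i' : ℕ) : ℝ) • corrDiff (popCov (ε i 0) P) (fun k => ε i k ω) (n t i)))
    (fun i => (h i).posSemidef_popUpsilon.smul (inv_nonneg.2 (hκ i).le))
    (fun t => iIndepFun_corrDiff h hindep _ _ _) fun i => ?_
  have hc : Tendsto (fun t => (√((n t i : ℝ) / ((∑ i', n t i' : ℕ) : ℝ)))⁻¹) atTop
      (𝓝 (√(κ i))⁻¹) := (hratio i).sqrt.inv₀ (Real.sqrt_pos.2 (hκ i)).ne'
  have hlim := tendstoInDistribution_smul_comp (h i).posSemidef_popUpsilon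
    ((h i).tendstoInDistribution_corrDiff (hvar i)) (hn i) hc
  rw [inv_pow, Real.sq_sqrt (hκ i).le] at hlim
  refine tendstoInDistribution_of_tendstoInMeasure_sub _ _ hlim ?_ fun t =>
    (WithLp.measurable_toLp 2 _).comp_aemeasurable
      (aemeasurable_pi_iff.2 fun l => ((h i).aemeasurable_corrDiff _ _ l).const_mul _)
  refine tendstoInMeasure_zero_of_norm_le
    (tendstoInMeasure_zero_const (E := EuclideanSpace ℝ (Fin (dimPu d)))) ?_
  -- the two sequences agree as soon as the group is not empty
  filter_upwards [(hn i).eventually_gt_atTop 0] with t ht ω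
  have hpos : 0 < √(n t i : ℝ) := Real.sqrt_pos.2 (by exact_mod_cast ht)
  rw [norm_zero, norm_le_zero_iff, Pi.sub_apply, Pi.sub_apply, sub_eq_zero, ← WithLp.toLp_smul,
    smul_smul, Real.sqrt_div (Nat.cast_nonneg _), inv_div, div_mul_cancel₀ _ hpos.ne']

end Pooled

end CorrAsymptotics

open CorrAsymptotics in
theorem theorem1 {Ω : Type*} [MeasurableSpace Ω] (P : Measure Ω) [IsProbabilityMeasure P]
    (a d : ℕ) (hd : 2 ≤ d)
    (μ : Fin a → EuclideanSpace ℝ (Fin d))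
    (ε X : Fin a → ℕ → Ω → EuclideanSpace ℝ (Fin d))
    (hX : ∀ i k ω, X i k ω = μ i + ε i k ω)
    (hindep : iIndepFun (fun ik : Fin a × ℕ => ε ik.1 ik.2) P)
    (hident : ∀ i k, IdentDistrib (ε i k) (ε i 0) P P)
    (hmean : ∀ i, ∫ ω, ε i 0 ω ∂P = 0)
    (hmom : ∀ i, MemLp (ε i 0) 4 P)
    (hvar : ∀ i j, 0 < popCov (ε i 0) P j j) :
    -- the linearization in each group
    (∀ i, TendstoInMeasure P
      (fun (n : ℕ) ω => WithLp.toLp 2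
        (√(n : ℝ) • corrDiff (popCov (ε i 0) P) (fun k => X i k ω) n
          - popM (ε i 0) P *ᵥ covError (popCov (ε i 0) P) (fun k => X i k ω) n))
      atTop (fun _ => (0 : EuclideanSpace ℝ (Fin (dimPu d))))) ∧
    -- asymptotic normality in each group
    (∀ i, TendstoInDistribution
      (fun (n : ℕ) ω => WithLp.toLp 2
        (√(n : ℝ) • corrDiff (popCov (ε i 0) P) (fun k => X i k ω) n))
      atTop (id : EuclideanSpace ℝ (Fin (dimPu d)) → EuclideanSpace ℝ (Fin (dimPu d)))
      (fun _ => P) (multivariateGaussian 0 (popUpsilon (ε i 0) P))) ∧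
    -- asymptotic normality of the pooled vector
    (∀ (n : ℕ → Fin a → ℕ) (κ : Fin a → ℝ),
      (∀ i, Tendsto (fun t => n t i) atTop atTop) →
      (∀ i, κ i ∈ Set.Ioc (0 : ℝ) 1) →
      (∀ i, Tendsto (fun t => (n t i : ℝ) / ((∑ i', n t i' : ℕ) : ℝ)) atTop (𝓝 (κ i))) →
      TendstoInDistribution
        (fun (t : ℕ) ω => WithLp.toLp 2 (fun il : (_ : Fin a) × Fin (dimPu d) =>
          √((∑ i', n t i' : ℕ) : ℝ) *
            corrDiff (popCov (ε il.1 0) P) (fun k => X il.1 k ω) (n t il.1) il.2))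
        atTop
        (id : EuclideanSpace ℝ ((_ : Fin a) × Fin (dimPu d)) →
          EuclideanSpace ℝ ((_ : Fin a) × Fin (dimPu d)))
        (fun _ => P)
        (multivariateGaussian 0
          (blockDiagonal' fun i => (κ i)⁻¹ • popUpsilon (ε i 0) P))) := by
  have h : ∀ i, IsCenteredIID (ε i) P := fun i =>
    ⟨hindep.precomp (g := fun k => (i, k)) fun _ _ hk => by simpa using hk,
      hident i, hmean i, hmom i⟩
  have hcorr : ∀ i V n ω, corrDiff V (fun k => X i k ω) n = corrDiff V (fun k => ε i k ω) n := by
    intro i V n ω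
    simp only [hX, corrDiff, sampleCov_add_const]
  have hcov : ∀ i V n ω, covError V (fun k => X i k ω) n = covError V (fun k => ε i k ω) n := by
    intro i V n ω
    simp only [hX, covError, sampleCov_add_const]
  simp only [hcorr, hcov]
  exact ⟨fun i => (h i).tendstoInMeasure_corrDiff_sub (hvar i),
    fun i => (h i).tendstoInDistribution_corrDiff (hvar i),
    fun n κ hn hκ hratio => tendstoInDistribution_pooled_corrDiff h hindep hvar hn
      (fun i => (hκ i).1) hratio⟩
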